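/- Let $n\in\mathbb{N}$, $n\ge 1$, and let $p=2$ if $n\in\{1,2,3\}$, respectively, $p\in(n/2,\infty)$ if $n\ge 4$. Let $V:\mathbb{R}^n\to\mathbb{R}$ belong to $L^p_{\rm loc\,unif}(\mathbb{R}^n)$, that is, $V\in L^p_{\rm loc}(\mathbb{R}^n)$ and $$\sup_{x\in\mathbb{R}^n}\|V\chi_{B_n(x;1)}\|_{L^p(\mathbb{R}^n)}<\infty,$$ where $B_n(x;1)$ is the open unit ball with center $x$. In the complex Hilbert space $L^2(\mathbb{R}^n)$ let $H_0=-\Delta$ with $\operatorname{dom}(H_0)=H^2(\mathbb{R}^n)$, and let $V$ also denote the maximal operator of multiplication by $V$, with domain $\{f\in L^2(\mathbb{R}^n)\mid Vf\in L^2(\mathbb{R}^n)\}$. Then $V$ is infinitesimally bounded, and hence infinitesimally form bounded, with respect to $H_0$: (i) $H_0$ is closed, $V$ is closable, $H^2(\mathbb{R}^n)\subseteq\operatorname{dom}(V)$, and for every $a>0$ there is $b\ge 0$ such that $$\|Vf\|_{L^2(\mathbb{R}^n)}\le a\,\|H_0f\|_{L^2(\mathbb{R}^n)}+b\,\|f\|_{L^2(\mathbb{R}^n)},\quad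 f\in H^2(\mathbb{R}^n);$$ (ii) $H_0$ is self-adjoint and bounded from below, $V$ is densely defined and closed, and $|V|^{1/2}$ is infinitesimally bounded with respect to $|H_0|^{1/2}$, that is, $\operatorname{dom}(|H_0|^{1/2})\subseteq\operatorname{dom}(|V|^{1/2})$ and for every $a>0$ there is $b\ge 0$ such that $$\big\||V|^{1/2}f\big\|_{L^2(\mathbb{R}^n)}\le a\,\big\||H_0|^{1/2}f\big\|_{L^2(\mathbb{R}^n)}+b\,\|f\|_{L^2(\mathbb{R}^n)},\quad f\in\operatorname{dom}(|H_0|^{1/2}).$$ Here, for a densely defined closed operator $A$, $|A|=(A^*A)^{1/2}$, and square roots of nonnegative self-adjoint operators are the nonnegative self-adjoint ones. -/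

import Mathlib

open MeasureTheory TemperedDistribution
open scoped ENNReal InnerProductSpace SchwartzMap LineDeriv Laplacian

noncomputable section

namespace RelativeBounds

/-! ### Unbounded operators in a complex Hilbert space -/

section Abstract

variable {H : Type*} [NormedAddCommGroup H] [InnerProductSpace ℂ H] [CompleteSpace H]

/-- The product `B A` of two unbounded operators, on its natural domain
`{f ∈ dom A | A f ∈ dom B}`. -/
def opComp (B A : H →ₗ.[ℂ] H) : H →ₗ.[ℂ] H :=
  B.comp (A.domRestrict ((B.domain.comap A.toFun).map A.domain.subtype)) (by
    rintro ⟨x, hx, hxA⟩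
    obtain ⟨y, hy, hyx⟩ := hx
    have h : A.domRestrict ((B.domain.comap A.toFun).map A.domain.subtype) ⟨x, ⟨y, hy, hyx⟩, hxA⟩
        = A y := LinearPMap.domRestrict_apply hyx.symm
    rw [h]
    exact hy)

/-- `0 ≤ (f, A f)` for all `f ∈ dom A`. -/
def IsNonneg (A : H →ₗ.[ℂ] H) : Prop :=
  ∀ f : A.domain, 0 ≤ (⟪(f : H), A f⟫_ℂ).re

/-- `A ≥ c I` for some real `c`. -/
def IsBoundedBelow (A : H →ₗ.[ℂ] H) : Prop :=
  ∃ c : ℝ, ∀ f : A.domain, c * ‖(f : H)‖ ^ 2 ≤ (⟪(f : H), A f⟫_ℂ).re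

/-- `S` is the nonnegative self-adjoint square root `P ^ (1 / 2)` of `P`. -/
def IsSqrt (S P : H →ₗ.[ℂ] H) : Prop :=
  IsSelfAdjoint S ∧ IsNonneg S ∧ opComp S S = P

/-- `P` is the absolute value `|A| = (A* A) ^ (1 / 2)` of the densely defined closed operator `A`.
-/
def IsAbs (P A : H →ₗ.[ℂ] H) : Prop :=
  IsSqrt P (opComp A.adjoint A)

/-- `S = |A| ^ (1 / 2)`. -/
def IsSqrtAbs (S A : H →ₗ.[ℂ] H) : Prop :=
  ∃ P : H →ₗ.[ℂ] H, IsAbs P A ∧ IsSqrt S P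

/-- The closable operator `B` is infinitesimally bounded with respect to the closed operator `A`:
`dom A ⊆ dom B`, and `‖B f‖ ≤ a ‖A f‖ + b ‖f‖` on `dom A` with `a > 0` as small as we please and
`b` depending on `a`; that is, the infimum of the admissible `a` (the `A`-bound of `B`) is `0`. -/
def InfinitesimallyBounded (A B : H →ₗ.[ℂ] H) : Prop :=
  A.IsClosed ∧ B.IsClosable ∧ ∃ hdom : A.domain ≤ B.domain,
    ∀ a : ℝ, 0 < a → ∃ b : ℝ, 0 ≤ b ∧
      ∀ f : A.domain, ‖B (Submodule.inclusion hdom f)‖ ≤ a * ‖A f‖ + b * ‖(f : H)‖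

/-- The densely defined closed operator `B` is infinitesimally form bounded with respect to the
self-adjoint operator `A` bounded from below: `|B| ^ (1 / 2)` is infinitesimally bounded with
respect to `|A| ^ (1 / 2)`; in particular `dom (|A| ^ (1 / 2)) ⊆ dom (|B| ^ (1 / 2))`.
(The operators `|A| ^ (1 / 2)` and `|B| ^ (1 / 2)` exist and are unique.) -/
def InfinitesimallyFormBounded (A B : H →ₗ.[ℂ] H) : Prop :=
  IsSelfAdjoint A ∧ IsBoundedBelow A ∧ Dense (B.domain : Set H) ∧ B.IsClosed ∧
    ∃ SA SB : H →ₗ.[ℂ] H, IsSqrtAbs SA A ∧ IsSqrtAbs SB B ∧ InfinitesimallyBounded SA SB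

end Abstract

/-! ### Function spaces and operators in `L²(ℝⁿ)` -/

/-- `f ∈ L^p_loc(ℝⁿ)`. -/
def MemLpLoc {n : ℕ} (f : EuclideanSpace ℝ (Fin n) → ℝ) (p : ℝ≥0∞) : Prop :=
  ∀ K : Set (EuclideanSpace ℝ (Fin n)), IsCompact K → MemLp f p (volume.restrict K)

/-- `f ∈ L^p_{loc unif}(ℝⁿ)`: `f ∈ L^p_loc(ℝⁿ)`, and the `L^p` norms of `f` over the open unit
balls are bounded. -/
def MemLpLocUnif {n : ℕ} (f : EuclideanSpace ℝ (Fin n) → ℝ) (p : ℝ≥0∞) : Prop :=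
  MemLpLoc f p ∧
    ⨆ x : EuclideanSpace ℝ (Fin n), eLpNorm ((Metric.ball x 1).indicator f) p volume < ∞

/-- The complex Hilbert space `L²(ℝⁿ)`. -/
abbrev L2 (n : ℕ) : Type :=
  Lp ℂ 2 (volume : Measure (EuclideanSpace ℝ (Fin n)))

/-- The tempered distribution defined by `f ∈ L²(ℝⁿ)`. -/
abbrev toDistr {n : ℕ} : L2 n →L[ℂ] 𝓢'(EuclideanSpace ℝ (Fin n), ℂ) :=
  Lp.toTemperedDistributionCLM ℂ volume 2

theorem toDistr_injective {n : ℕ} : Function.Injective (toDistr (n := n)) :=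
  LinearMap.ker_eq_bot.mp Lp.ker_toTemperedDistributionCLM_eq_bot

/-- The Sobolev space `H²(ℝⁿ)` as a subspace of `L²(ℝⁿ)`. -/
def sobolevH2 (n : ℕ) : Submodule ℂ (L2 n) where
  carrier := {f | MemSobolev 2 2 (toDistr f)}
  add_mem' {f g} hf hg := by
    simpa only [Set.mem_ofPred_eq, map_add] using MemSobolev.add hf hg
  zero_mem' := by
    simp only [Set.mem_ofPred_eq, map_zero]
    exact memSobolev_fun_zero _ _ _ _
  smul_mem' c f hf := by
    simpa only [Set.mem_ofPred_eq, map_smul] using MemSobolev.smul c hf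

theorem exists_laplacian {n : ℕ} (f : sobolevH2 n) :
    ∃ g : L2 n, toDistr g = -Δ (toDistr (f : L2 n)) := by
  have h : MemSobolev (2 - 2) 2 (Δ (toDistr (f : L2 n))) := MemSobolev.laplacian f.2
  rw [sub_self, memSobolev_zero_iff] at h
  obtain ⟨g, hg⟩ := h
  refine ⟨-g, ?_⟩
  rw [map_neg, hg]
  rfl

/-- The operator `H₀ = -Δ` in `L²(ℝⁿ)` with domain `H²(ℝⁿ)`: for `f ∈ H²(ℝⁿ)`, `H₀ f` is the
element of `L²(ℝⁿ)` that represents the distribution `-Δ f`. -/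
def freeHamiltonian (n : ℕ) : L2 n →ₗ.[ℂ] L2 n where
  domain := sobolevH2 n
  toFun :=
    { toFun := fun f => (exists_laplacian f).choose
      map_add' := fun f g => toDistr_injective <| by
        rw [map_add, (exists_laplacian f).choose_spec, (exists_laplacian g).choose_spec,
          (exists_laplacian (f + g)).choose_spec]
        simp only [Submodule.coe_add, map_add, ← laplacianCLM_apply]
        abel
      map_smul' := fun c f => toDistr_injective <| by
        rw [map_smul, (exists_laplacian f).choose_spec, (exists_laplacian (c • f)).choose_spec]
        simp only [Submodule.coe_smul, map_smul, ← laplacianCLM_apply, smul_neg, RingHom.id_apply] }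

theorem toDistr_freeHamiltonian {n : ℕ} (f : (freeHamiltonian n).domain) :
    toDistr (freeHamiltonian n f) = -Δ (toDistr (f : L2 n)) :=
  (exists_laplacian f).choose_spec

theorem mul_add_ae {n : ℕ} (V : EuclideanSpace ℝ (Fin n) → ℝ) (f g : L2 n) :
    (fun x => (V x : ℂ) * (f + g : L2 n) x) =ᵐ[volume]
      (fun x => (V x : ℂ) * f x) + fun x => (V x : ℂ) * g x := by
  filter_upwards [Lp.coeFn_add f g] with x hx
  simp only [hx, Pi.add_apply, mul_add]

theorem mul_smul_ae {n : ℕ} (V : EuclideanSpace ℝ (Fin n) → ℝ) (c : ℂ) (f : L2 n) :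
    (fun x => (V x : ℂ) * (c • f : L2 n) x) =ᵐ[volume] c • fun x => (V x : ℂ) * f x := by
  filter_upwards [Lp.coeFn_smul c f] with x hx
  simp only [hx, Pi.smul_apply, smul_eq_mul, mul_left_comm]

/-- The maximal operator of multiplication by the real-valued function `V` in `L²(ℝⁿ)`, with
domain `{f ∈ L²(ℝⁿ) | V f ∈ L²(ℝⁿ)}`. -/
def multiplication {n : ℕ} (V : EuclideanSpace ℝ (Fin n) → ℝ) : L2 n →ₗ.[ℂ] L2 n where
  domain :=
    { carrier := {f | MemLp (fun x => (V x : ℂ) * f x) 2 volume}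
      add_mem' := fun {f g} hf hg => (memLp_congr_ae (mul_add_ae V f g)).mpr (hf.add hg)
      zero_mem' := (memLp_congr_ae (by
        filter_upwards [Lp.coeFn_zero ℂ 2 (volume : Measure (EuclideanSpace ℝ (Fin n)))] with x hx
        rw [hx, Pi.zero_apply, mul_zero])).mpr (MemLp.zero' (ε := ℂ))
      smul_mem' := fun c f hf => (memLp_congr_ae (mul_smul_ae V c f)).mpr (hf.const_smul c) }
  toFun :=
    { toFun := fun f => MemLp.toLp (fun x => (V x : ℂ) * (f : L2 n) x) f.2
      map_add' := fun f g => by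
        rw [← MemLp.toLp_add]
        exact MemLp.toLp_congr _ _ (mul_add_ae V f g)
      map_smul' := fun c f => by
        rw [RingHom.id_apply, ← MemLp.toLp_const_smul]
        exact MemLp.toLp_congr _ _ (mul_smul_ae V c f) }

end RelativeBounds

end

noncomputable section

namespace RelativeBounds

section Operators

variable {H : Type*} [NormedAddCommGroup H] [InnerProductSpace ℂ H] [CompleteSpace H]

omit [CompleteSpace H] in
theorem linearPMap_apply_congr (A : H →ₗ.[ℂ] H) {x y : H} (h : x = y) (hx : x ∈ A.domain)
    (hy : y ∈ A.domain) : A ⟨x, hx⟩ = A ⟨y, hy⟩ := by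
  subst h; rfl

/-- A densely defined symmetric operator is self-adjoint when every vector of the domain of its
adjoint already belongs to its domain. -/
theorem isSelfAdjoint_of_symmetric {A : H →ₗ.[ℂ] H} (hd : Dense (A.domain : Set H))
    (hs : A.IsFormalAdjoint A)
    (hm : ∀ y w : H, (∀ x : A.domain, ⟪w, (x : H)⟫_ℂ = ⟪y, A x⟫_ℂ) → y ∈ A.domain) :
    IsSelfAdjoint A := by
  rw [LinearPMap.isSelfAdjoint_def]
  have hle : A ≤ A.adjoint := hs.le_adjoint hd
  refine (LinearPMap.eq_of_le_of_domain_eq hle (le_antisymm hle.1 ?_)).symm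
  intro y hy
  exact hm y (A.adjoint ⟨y, hy⟩) fun x => A.adjoint_isFormalAdjoint hd ⟨y, hy⟩ x

omit [CompleteSpace H] in
theorem mem_domain_opComp {A B : H →ₗ.[ℂ] H} {x : H} :
    x ∈ (opComp B A).domain ↔ ∃ hx : x ∈ A.domain, A ⟨x, hx⟩ ∈ B.domain := by
  constructor
  · rintro ⟨⟨y, hy, rfl⟩, hA⟩
    exact ⟨hA, hy⟩
  · rintro ⟨hx, hA⟩
    exact ⟨⟨⟨x, hx⟩, hA, rfl⟩, hx⟩

omit [CompleteSpace H] in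
theorem opComp_apply {A B : H →ₗ.[ℂ] H} {x : H} (h : x ∈ (opComp B A).domain)
    (hx : x ∈ A.domain) (hA : A ⟨x, hx⟩ ∈ B.domain) :
    opComp B A ⟨x, h⟩ = B ⟨A ⟨x, hx⟩, hA⟩ :=
  linearPMap_apply_congr B (LinearPMap.domRestrict_apply rfl) _ _

/-- The operator `U⁻¹ A U` for a unitary operator `U`. -/
def unitaryConj (U : H ≃ₗᵢ[ℂ] H) (A : H →ₗ.[ℂ] H) : H →ₗ.[ℂ] H where
  domain := A.domain.comap U.toLinearEquiv.toLinearMap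
  toFun :=
    { toFun := fun x => U.symm (A ⟨U x, x.2⟩)
      map_add' := fun x y => by
        rw [← map_add, ← A.map_add]
        exact congrArg _ (linearPMap_apply_congr A (map_add U _ _) _ _)
      map_smul' := fun c x => by
        rw [RingHom.id_apply, ← map_smul, ← A.map_smul]
        exact congrArg _ (linearPMap_apply_congr A (map_smul U _ _) _ _) }

omit [CompleteSpace H] in
theorem mem_domain_unitaryConj {U : H ≃ₗᵢ[ℂ] H} {A : H →ₗ.[ℂ] H} {x : H} :
    x ∈ (unitaryConj U A).domain ↔ U x ∈ A.domain :=
  Iff.rfl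

omit [CompleteSpace H] in
theorem unitaryConj_apply (U : H ≃ₗᵢ[ℂ] H) (A : H →ₗ.[ℂ] H) {x : H}
    (hx : x ∈ (unitaryConj U A).domain) :
    unitaryConj U A ⟨x, hx⟩ = U.symm (A ⟨U x, hx⟩) :=
  rfl

omit [CompleteSpace H] in
theorem inner_unitaryConj (U : H ≃ₗᵢ[ℂ] H) (A : H →ₗ.[ℂ] H) (x : (unitaryConj U A).domain)
    (y : H) : ⟪y, unitaryConj U A x⟫_ℂ = ⟪U y, A ⟨U x, x.2⟩⟫_ℂ := by
  rw [← U.inner_map_map, unitaryConj_apply U A x.2, U.apply_symm_apply]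

theorem isSelfAdjoint_unitaryConj (U : H ≃ₗᵢ[ℂ] H) {A : H →ₗ.[ℂ] H} (hA : IsSelfAdjoint A) :
    IsSelfAdjoint (unitaryConj U A) := by
  have hd := hA.dense_domain
  have hAA := LinearPMap.isSelfAdjoint_def.mp hA
  have hsym : A.IsFormalAdjoint A := by
    have := A.adjoint_isFormalAdjoint hd
    rwa [hAA] at this
  refine isSelfAdjoint_of_symmetric ?_ ?_ ?_
  · exact hd.preimage U.toHomeomorph.isOpenMap
  · intro x y
    rw [inner_unitaryConj, ← inner_conj_symm, inner_unitaryConj, inner_conj_symm]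
    exact hsym ⟨U x, x.2⟩ ⟨U y, y.2⟩
  · intro y w h
    rw [mem_domain_unitaryConj]
    have : U y ∈ A.adjoint.domain := by
      refine LinearPMap.mem_adjoint_domain_of_exists _ ⟨U w, fun x => ?_⟩
      have hx : U.symm x ∈ (unitaryConj U A).domain := by
        rw [mem_domain_unitaryConj, U.apply_symm_apply]
        exact x.2
      have := h ⟨U.symm x, hx⟩
      rw [inner_unitaryConj, ← U.inner_map_map] at this
      simp only [U.apply_symm_apply] at this
      exact this
    rwa [hAA] at this

omit [CompleteSpace H] in
theorem isNonneg_unitaryConj (U : H ≃ₗᵢ[ℂ] H) {A : H →ₗ.[ℂ] H} (hA : IsNonneg A) :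
    IsNonneg (unitaryConj U A) := by
  intro f
  rw [inner_unitaryConj]
  exact hA ⟨U f, f.2⟩

omit [CompleteSpace H] in
theorem opComp_unitaryConj (U : H ≃ₗᵢ[ℂ] H) (A B : H →ₗ.[ℂ] H) :
    opComp (unitaryConj U B) (unitaryConj U A) = unitaryConj U (opComp B A) := by
  have hiff : ∀ x, x ∈ (opComp (unitaryConj U B) (unitaryConj U A)).domain ↔
      x ∈ (unitaryConj U (opComp B A)).domain := by
    intro x
    rw [mem_domain_unitaryConj, mem_domain_opComp, mem_domain_opComp]
    refine exists_congr fun hx => ?_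
    rw [mem_domain_unitaryConj, unitaryConj_apply, U.apply_symm_apply]
  refine LinearPMap.ext (Submodule.ext hiff) fun x hx hx' => ?_
  obtain ⟨h1, h2⟩ := mem_domain_opComp.mp hx
  obtain ⟨h3, h4⟩ := mem_domain_opComp.mp (mem_domain_unitaryConj.mp hx')
  rw [opComp_apply hx h1 h2]
  refine (congrArg U.symm ?_ : U.symm _ = U.symm _)
  rw [opComp_apply _ h3 h4]
  exact linearPMap_apply_congr B (U.apply_symm_apply _) _ _

theorem IsSqrt.unitaryConj (U : H ≃ₗᵢ[ℂ] H) {S P : H →ₗ.[ℂ] H} (h : IsSqrt S P) :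
    IsSqrt (unitaryConj U S) (unitaryConj U P) :=
  ⟨isSelfAdjoint_unitaryConj U h.1, isNonneg_unitaryConj U h.2.1, by
    rw [opComp_unitaryConj, h.2.2]⟩

theorem isAbs_self {A : H →ₗ.[ℂ] H} (hA : IsSelfAdjoint A) (h : IsNonneg A) : IsAbs A A :=
  ⟨hA, h, by rw [LinearPMap.isSelfAdjoint_def.mp hA]⟩

end Operators

section Multiplication

variable {n : ℕ}

local notation "E" => EuclideanSpace ℝ (Fin n)

theorem mem_domain_multiplication {V : E → ℝ} {f : L2 n} :
    f ∈ (multiplication V).domain ↔ MemLp (fun x => (V x : ℂ) * f x) 2 volume :=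
  Iff.rfl

theorem coeFn_multiplication (V : E → ℝ) (f : (multiplication V).domain) :
    multiplication V f =ᵐ[volume] fun x => (V x : ℂ) * (f : L2 n) x :=
  MemLp.coeFn_toLp f.2

theorem memLp_ofReal_mul {φ : E → ℝ} (hφ : AEStronglyMeasurable φ volume) {c : ℝ}
    (hc : ∀ x, |φ x| ≤ c) (f : L2 n) : MemLp (fun x => (φ x : ℂ) * f x) 2 volume := by
  refine MemLp.of_le_mul (c := c) (Lp.memLp f)
    ((Complex.continuous_ofReal.comp_aestronglyMeasurable hφ).mul (Lp.aestronglyMeasurable f)) ?_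
  refine Filter.Eventually.of_forall fun x => ?_
  rw [norm_mul, Complex.norm_real]
  exact mul_le_mul_of_nonneg_right (hc x) (norm_nonneg _)

/-- Multiplication by the bounded factor `(1 + |V|)⁻¹`, which maps `L²` into the domain of
multiplication by `V`. -/
theorem exists_regularized {V : E → ℝ} (hV : AEStronglyMeasurable V volume) (h : L2 n) :
    ∃ f : L2 n, f ∈ (multiplication V).domain ∧
      f =ᵐ[volume] fun x => (((1 + |V x|)⁻¹ : ℝ) : ℂ) * h x := by
  have hφ : AEStronglyMeasurable (fun x => (1 + |V x|)⁻¹) volume :=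
    ((hV.aemeasurable.norm.const_add 1).inv).aestronglyMeasurable
  have hψ : AEStronglyMeasurable (fun x => V x * (1 + |V x|)⁻¹) volume := hV.mul hφ
  have hpos : ∀ x, 0 < 1 + |V x| := fun x => by positivity
  have h1 : MemLp (fun x => (((1 + |V x|)⁻¹ : ℝ) : ℂ) * h x) 2 volume :=
    memLp_ofReal_mul hφ (c := 1) (fun x => by
      rw [abs_of_pos (inv_pos.mpr (hpos x))]
      exact inv_le_one_of_one_le₀ (by linarith [abs_nonneg (V x)])) h
  have h2 : MemLp (fun x => ((V x * (1 + |V x|)⁻¹ : ℝ) : ℂ) * h x) 2 volume :=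
    memLp_ofReal_mul hψ (c := 1) (fun x => by
      rw [abs_mul, abs_of_pos (inv_pos.mpr (hpos x)), ← div_eq_mul_inv, div_le_one (hpos x)]
      linarith) h
  refine ⟨h1.toLp, ?_, h1.coeFn_toLp⟩
  rw [mem_domain_multiplication]
  refine (memLp_congr_ae ?_).mp h2
  filter_upwards [h1.coeFn_toLp] with x hx
  rw [hx]
  push_cast
  ring

theorem isSelfAdjoint_multiplication {V : E → ℝ} (hV : AEStronglyMeasurable V volume) :
    IsSelfAdjoint (multiplication V) := by
  refine isSelfAdjoint_of_symmetric ?_ ?_ ?_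
  · rw [Submodule.dense_iff_topologicalClosure_eq_top, Submodule.topologicalClosure_eq_top_iff,
      Submodule.eq_bot_iff]
    intro g hg
    obtain ⟨f, hf, hfg⟩ := exists_regularized hV g
    have h0 := (Submodule.mem_orthogonal _ _).mp hg f hf
    rw [MeasureTheory.L2.inner_def] at h0
    have hEq : (fun x => ⟪f x, g x⟫_ℂ) =ᵐ[volume]
        fun x => (((1 + |V x|)⁻¹ * ‖g x‖ ^ 2 : ℝ) : ℂ) := by
      filter_upwards [hfg] with x hx
      rw [hx, ← smul_eq_mul, inner_smul_left, inner_self_eq_norm_sq_to_K, Complex.conj_ofReal]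
      push_cast
      rfl
    have hint : Integrable (fun x => (1 + |V x|)⁻¹ * ‖g x‖ ^ 2) volume :=
      ((L2.integrable_inner (𝕜 := ℂ) f g).congr hEq).re.congr
        (Filter.Eventually.of_forall fun x => Complex.ofReal_re _)
    rw [integral_congr_ae hEq, integral_complex_ofReal] at h0
    have h0' : ∫ x, (1 + |V x|)⁻¹ * ‖g x‖ ^ 2 = 0 := by exact_mod_cast h0
    rw [integral_eq_zero_iff_of_nonneg (fun x => by positivity) hint] at h0'
    rw [Lp.eq_zero_iff_ae_eq_zero]
    filter_upwards [h0'] with x hx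
    have hpos : (1 + |V x|)⁻¹ ≠ 0 := by positivity
    simpa [hpos] using hx
  · intro f g
    rw [L2.inner_def, L2.inner_def]
    refine integral_congr_ae ?_
    filter_upwards [coeFn_multiplication V f, coeFn_multiplication V g] with x h1 h2
    rw [h1, h2]
    simp only [RCLike.inner_apply, map_mul, Complex.conj_ofReal]
    ring
  · intro y w h
    rw [mem_domain_multiplication]
    have key : (fun x => (((1 + |V x|)⁻¹ : ℝ) : ℂ) * w x) =ᵐ[volume]
        fun x => ((V x * (1 + |V x|)⁻¹ : ℝ) : ℂ) * y x := by
      obtain ⟨w', -, hw'⟩ := exists_regularized hV w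
      obtain ⟨y', hy, hy'⟩ := exists_regularized hV y
      have hVy := coeFn_multiplication V ⟨y', hy⟩
      have : w' = multiplication V ⟨y', hy⟩ := by
        refine ext_inner_right ℂ fun u => ?_
        obtain ⟨u', hu, hu'⟩ := exists_regularized hV u
        have hVu := coeFn_multiplication V ⟨u', hu⟩
        have := h ⟨u', hu⟩
        rw [L2.inner_def, L2.inner_def] at this ⊢
        convert this using 1
        · refine integral_congr_ae ?_
          filter_upwards [hw', hu'] with x h1 h2
          simp only [h1, h2, RCLike.inner_apply, map_mul, Complex.conj_ofReal]
          ring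
        · refine integral_congr_ae ?_
          filter_upwards [hy', hu', hVy, hVu] with x h1 h2 h3 h4
          simp only [h1, h2, h3, h4, RCLike.inner_apply, map_mul, Complex.conj_ofReal]
          ring
      rw [this] at hw'
      filter_upwards [hw', hVy, hy'] with x h1 h2 h3
      rw [← h1, h2, h3]
      push_cast
      ring
    refine (memLp_congr_ae ?_).mp (Lp.memLp w)
    filter_upwards [key] with x hx
    have hpos : ((1 + |V x| : ℝ) : ℂ) ≠ 0 := by
      rw [Complex.ofReal_ne_zero]; positivity
    have := congrArg (((1 + |V x| : ℝ) : ℂ) * ·) hx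
    push_cast at this hpos
    field_simp at this
    exact this

theorem isNonneg_multiplication {V : E → ℝ} (hV : ∀ x, 0 ≤ V x) :
    IsNonneg (multiplication V) := by
  intro f
  rw [L2.inner_def]
  have hEq : (fun x => ⟪(f : L2 n) x, multiplication V f x⟫_ℂ) =ᵐ[volume]
      fun x => ((V x * ‖(f : L2 n) x‖ ^ 2 : ℝ) : ℂ) := by
    filter_upwards [coeFn_multiplication V f] with x hx
    rw [hx, ← smul_eq_mul, inner_smul_right, inner_self_eq_norm_sq_to_K]
    push_cast
    rfl
  rw [integral_congr_ae hEq, integral_complex_ofReal]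
  rw [Complex.ofReal_re]
  exact integral_nonneg fun x => mul_nonneg (hV x) (by positivity)

theorem opComp_multiplication_self {V W : E → ℝ} (hV : AEStronglyMeasurable V volume)
    (hW : ∀ x, V x * V x = W x) :
    opComp (multiplication V) (multiplication V) = multiplication W := by
  have hiff : ∀ f, f ∈ (opComp (multiplication V) (multiplication V)).domain ↔
      f ∈ (multiplication W).domain := by
    intro f
    rw [mem_domain_opComp]
    constructor
    · rintro ⟨hf, hVf⟩
      refine (memLp_congr_ae ?_).mp (mem_domain_multiplication.mp hVf)
      filter_upwards [coeFn_multiplication V ⟨f, hf⟩] with x hx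
      rw [hx, ← hW x]
      push_cast
      ring
    · intro hf
      have hVf : f ∈ (multiplication V).domain := by
        refine MemLp.of_le ((Lp.memLp f).norm.add (mem_domain_multiplication.mp hf).norm)
          ((Complex.continuous_ofReal.comp_aestronglyMeasurable hV).mul
            (Lp.aestronglyMeasurable f)) (Filter.Eventually.of_forall fun x => ?_)
        simp only [Pi.add_apply, norm_mul, Complex.norm_real, ← hW x, Real.norm_eq_abs, abs_mul]
        rw [abs_of_nonneg (by positivity : (0 : ℝ) ≤ ‖f x‖ + |V x| * |V x| * ‖f x‖)]
        nlinarith [norm_nonneg (f x), abs_nonneg (V x),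
          mul_nonneg (norm_nonneg (f x)) (sq_nonneg (|V x| - 1)),
          mul_nonneg (norm_nonneg (f x)) (mul_nonneg (abs_nonneg (V x)) (abs_nonneg (V x)))]
      refine ⟨hVf, (memLp_congr_ae ?_).mp (mem_domain_multiplication.mp hf)⟩
      filter_upwards [coeFn_multiplication V ⟨f, hVf⟩] with x hx
      rw [hx, ← hW x]
      push_cast
      ring
  refine LinearPMap.ext (Submodule.ext hiff) fun f hf hf' => ?_
  obtain ⟨h1, h2⟩ := mem_domain_opComp.mp hf
  rw [opComp_apply hf h1 h2]
  refine Lp.ext ?_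
  filter_upwards [coeFn_multiplication V ⟨f, h1⟩, coeFn_multiplication V ⟨_, h2⟩,
    coeFn_multiplication W ⟨f, hf'⟩] with x e1 e2 e3
  rw [e2, e1, e3, ← hW x]
  push_cast
  ring

theorem isSqrt_multiplication {V W : E → ℝ} (hV : AEStronglyMeasurable V volume)
    (h0 : ∀ x, 0 ≤ V x) (hW : ∀ x, V x * V x = W x) :
    IsSqrt (multiplication V) (multiplication W) :=
  ⟨isSelfAdjoint_multiplication hV, isNonneg_multiplication h0, opComp_multiplication_self hV hW⟩

theorem isSqrtAbs_multiplication {V : E → ℝ} (hV : AEStronglyMeasurable V volume) :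
    IsSqrtAbs (multiplication fun x => √|V x|) (multiplication V) := by
  have habs : AEStronglyMeasurable (fun x => |V x|) volume := hV.norm
  refine ⟨multiplication fun x => |V x|, ⟨isSelfAdjoint_multiplication habs,
    isNonneg_multiplication fun x => abs_nonneg _, ?_⟩, isSqrt_multiplication
      (Real.continuous_sqrt.comp_aestronglyMeasurable habs) (fun x => Real.sqrt_nonneg _)
      fun x => Real.mul_self_sqrt (abs_nonneg _)⟩
  rw [LinearPMap.isSelfAdjoint_def.mp (isSelfAdjoint_multiplication hV),
    opComp_multiplication_self (W := fun x => V x * V x) habs fun x => abs_mul_abs_self _,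
    opComp_multiplication_self hV fun x => rfl]

end Multiplication

section Fourier

open FourierTransform
open scoped ContDiff

variable {n : ℕ}

local notation "E" => EuclideanSpace ℝ (Fin n)

theorem toDistr_apply (f : L2 n) (u : 𝓢(EuclideanSpace ℝ (Fin n), ℂ)) :
    toDistr f u = ∫ x, u x • f x :=
  Lp.toTemperedDistribution_apply f u

theorem locallyIntegrable_L2 (f : L2 n) : LocallyIntegrable f volume :=
  (Lp.memLp f).locallyIntegrable one_le_two

/-- Two locally integrable functions that define the same functional on Schwartz functions agree
almost everywhere. -/
theorem ae_eq_of_integral_schwartz {f g : E → ℂ} (hf : LocallyIntegrable f volume)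
    (hg : LocallyIntegrable g volume)
    (h : ∀ u : 𝓢(EuclideanSpace ℝ (Fin n), ℂ), ∫ x, u x • f x = ∫ x, u x • g x) :
    f =ᵐ[volume] g := by
  refine ae_eq_of_integral_contDiff_smul_eq hf hg fun φ hφ hc => ?_
  have hc' : HasCompactSupport (Complex.ofRealCLM ∘ φ) := hc.comp_left rfl
  have hφ' : ContDiff ℝ ∞ (Complex.ofRealCLM ∘ φ) := Complex.ofRealCLM.contDiff.comp hφ
  simpa using h (hc'.toSchwartzMap hφ')

theorem integral_fourierInv_smul_eq {f g : E → ℂ} (hf : Integrable f volume)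
    (hg : Integrable g volume) : ∫ x, 𝓕⁻ f x • g x = ∫ x, f x • 𝓕⁻ g x := by
  have hflip : (-innerₗ E).flip = -innerₗ E := by
    ext x y
    simp [real_inner_comm]
  have h := VectorFourier.integral_fourierIntegral_smul_eq_flip (L := -innerₗ E)
    (μ := volume) (ν := volume) Real.continuous_fourierChar
    (continuous_inner.neg : Continuous fun p : E × E => -⟪p.1, p.2⟫_ℝ) hf hg
  rw [hflip] at h
  exact h

/-- On `L¹ ∩ L²` the inverse Fourier transform of `L²` is given by the Fourier integral. -/
theorem fourierInv_toLp_ae_eq {g : E → ℂ} (h1 : Integrable g volume) (h2 : MemLp g 2 volume) :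
    (𝓕⁻ (h2.toLp g) : L2 n) =ᵐ[volume] 𝓕⁻ g := by
  have hcont : Continuous (𝓕⁻ g : E → ℂ) :=
    VectorFourier.fourierIntegral_continuous (L := -innerₗ E) Real.continuous_fourierChar
      (continuous_inner.neg : Continuous fun p : E × E => -⟪p.1, p.2⟫_ℝ) h1
  refine ae_eq_of_integral_schwartz (locallyIntegrable_L2 _) hcont.locallyIntegrable fun u => ?_
  have e1 : toDistr (𝓕⁻ (h2.toLp g) : L2 n) u = toDistr (h2.toLp g) (𝓕⁻ u) :=
    (DFunLike.congr_fun (Lp.fourierInv_toTemperedDistribution_eq (h2.toLp g)) u).symm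
  rw [toDistr_apply, toDistr_apply] at e1
  rw [e1, ← integral_fourierInv_smul_eq u.integrable h1, SchwartzMap.fourierInv_coe]
  refine integral_congr_ae ?_
  filter_upwards [h2.coeFn_toLp] with x hx
  rw [hx]

/-- A function of temperate growth acts on `L²` elements, seen as distributions, by pointwise
multiplication. -/
theorem smulLeftCLM_toDistr_eq_iff {φ : E → ℂ} (hφ : φ.HasTemperateGrowth) (f g : L2 n) :
    smulLeftCLM ℂ φ (toDistr f) = toDistr g ↔ (fun x => φ x * f x) =ᵐ[volume] g := by
  have key : ∀ u : 𝓢(EuclideanSpace ℝ (Fin n), ℂ),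
      smulLeftCLM ℂ φ (toDistr f) u = ∫ x, u x • (φ x * f x) := by
    intro u
    rw [smulLeftCLM_apply_apply, toDistr_apply]
    refine integral_congr_ae (Filter.Eventually.of_forall fun x => ?_)
    simp only [SchwartzMap.smulLeftCLM_apply_apply hφ, smul_eq_mul]
    ring
  constructor
  · intro h
    refine ae_eq_of_integral_schwartz ?_ (locallyIntegrable_L2 g) fun u => ?_
    · exact (locallyIntegrable_L2 f).continuous_smul hφ.1.continuous
    · rw [← key u, h, toDistr_apply]
  · intro h
    ext u
    rw [key u, toDistr_apply]
    refine integral_congr_ae ?_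
    filter_upwards [h] with x hx
    rw [hx]

/-- The Fourier transform as a unitary operator in `L²(ℝⁿ)`. -/
abbrev fourierL2 (n : ℕ) : L2 n ≃ₗᵢ[ℂ] L2 n :=
  Lp.fourierTransformₗᵢ (EuclideanSpace ℝ (Fin n)) ℂ

theorem fourier_toDistr (f : L2 n) : 𝓕 (toDistr f) = toDistr (fourierL2 n f) :=
  Lp.fourier_toTemperedDistribution_eq f

/-- The symbol `(2π|ξ|) ^ 2` of `-Δ`. -/
def laplaceSymbol (ξ : EuclideanSpace ℝ (Fin n)) : ℝ := (2 * Real.pi * ‖ξ‖) ^ 2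

theorem continuous_laplaceSymbol : Continuous (laplaceSymbol (n := n)) := by
  unfold laplaceSymbol; fun_prop

theorem laplaceSymbol_nonneg (ξ : E) : 0 ≤ laplaceSymbol ξ := sq_nonneg _

theorem mem_sobolevH2_iff (f : L2 n) :
    f ∈ sobolevH2 n ↔ fourierL2 n f ∈ (multiplication (laplaceSymbol (n := n))).domain := by
  have hg : (fun x : E => (((1 + ‖x‖ ^ 2) ^ ((2 : ℝ) / 2) : ℝ) : ℂ)).HasTemperateGrowth := by
    fun_prop
  change MemSobolev 2 2 (toDistr f) ↔ _
  rw [memSobolev_iff_exists_smulLeftCLM_fourier, fourier_toDistr, mem_domain_multiplication]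
  set h := fourierL2 n f
  have hpow : ∀ x : E, (1 + ‖x‖ ^ 2) ^ ((2 : ℝ) / 2) = 1 + ‖x‖ ^ 2 := fun x => by simp
  have hsq : ∀ x : E, laplaceSymbol x = (2 * Real.pi) ^ 2 * ‖x‖ ^ 2 := fun x => by
    unfold laplaceSymbol; ring
  constructor
  · rintro ⟨g, hg'⟩
    rw [show (g : 𝓢'(E, ℂ)) = toDistr g from rfl, smulLeftCLM_toDistr_eq_iff hg] at hg'
    refine (memLp_congr_ae ?_).mp
      (((Lp.memLp g).sub (Lp.memLp h)).const_mul ((2 * Real.pi : ℂ) ^ 2))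
    filter_upwards [hg'] with x hx
    rw [Pi.sub_apply, ← hx, hpow, hsq]
    push_cast
    ring
  · intro hm
    have hm' : MemLp (fun x => (((1 + ‖x‖ ^ 2) ^ ((2 : ℝ) / 2) : ℝ) : ℂ) * h x) 2 volume := by
      refine (memLp_congr_ae (Filter.Eventually.of_forall fun x => ?_)).mp
        ((Lp.memLp h).add (hm.const_mul (((2 * Real.pi : ℂ) ^ 2)⁻¹)))
      have hpi : (Real.pi : ℂ) ≠ 0 := Complex.ofReal_ne_zero.mpr Real.pi_ne_zero
      simp only [Pi.add_apply]
      rw [hpow, hsq]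
      push_cast
      field_simp
    refine ⟨hm'.toLp, ?_⟩
    rw [show ((hm'.toLp : L2 n) : 𝓢'(E, ℂ)) = toDistr hm'.toLp from rfl,
      smulLeftCLM_toDistr_eq_iff hg]
    exact hm'.coeFn_toLp.symm

/-- `-Δ` is unitarily equivalent, through the Fourier transform, to multiplication by
`(2π|ξ|) ^ 2`. -/
theorem freeHamiltonian_eq :
    freeHamiltonian n = unitaryConj (fourierL2 n) (multiplication laplaceSymbol) := by
  refine LinearPMap.ext (Submodule.ext fun f => mem_sobolevH2_iff f) fun f hf hf' => ?_
  rw [unitaryConj_apply, LinearIsometryEquiv.eq_symm_apply]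
  have hg : (fun x : E => ((‖x‖ ^ 2 : ℝ) : ℂ)).HasTemperateGrowth := by fun_prop
  have h1 := congrArg 𝓕 (toDistr_freeHamiltonian ⟨f, hf⟩)
  rw [fourier_toDistr, laplacian_eq_fourierMultiplierCLM, fourierMultiplierCLM_apply,
    neg_smul, neg_neg] at h1
  have h2 : ∀ u, toDistr (fourierL2 n (freeHamiltonian n ⟨f, hf⟩)) u =
      (2 * Real.pi) ^ 2 • smulLeftCLM ℂ (fun x : E => ((‖x‖ ^ 2 : ℝ) : ℂ))
        (toDistr (fourierL2 n f)) u := by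
    intro u
    rw [h1, ← fourier_toDistr, TemperedDistribution.fourier_apply]
    change (2 * Real.pi) ^ 2 • (𝓕⁻ (smulLeftCLM ℂ (fun x : E => ((‖x‖ ^ 2 : ℝ) : ℂ))
      (𝓕 (toDistr f))) : 𝓢'(E, ℂ)) (𝓕 u) = _
    rw [TemperedDistribution.fourierInv_apply, fourierInv_fourier_eq]
  refine Lp.ext ((ae_eq_of_integral_schwartz (locallyIntegrable_L2 _)
    (((locallyIntegrable_L2 (fourierL2 n f)).continuous_smul hg.1.continuous).smul
      ((2 * Real.pi) ^ 2)) fun u => ?_).trans ?_)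
  · rw [← toDistr_apply, h2, smulLeftCLM_apply_apply, toDistr_apply, ← integral_smul]
    refine integral_congr_ae (Filter.Eventually.of_forall fun x => ?_)
    simp only [SchwartzMap.smulLeftCLM_apply_apply hg, smul_eq_mul, Pi.smul_apply,
      Complex.real_smul]
    ring
  · filter_upwards [coeFn_multiplication laplaceSymbol ⟨fourierL2 n f, hf'⟩] with x hx
    rw [hx, laplaceSymbol]
    simp only [Pi.smul_apply, smul_eq_mul, Complex.real_smul]
    push_cast
    ring

end Fourier

section Heat

open FourierTransform

variable {n : ℕ}

local notation "E" => EuclideanSpace ℝ (Fin n)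

/-- Multiplication by a function bounded by `1` as a bounded operator in `L²(ℝⁿ)`. -/
def boundedMul (φ : EuclideanSpace ℝ (Fin n) → ℝ) (hφ : AEStronglyMeasurable φ volume)
    (hc : ∀ x, |φ x| ≤ 1) : L2 n →L[ℂ] L2 n :=
  LinearMap.mkContinuous
    { toFun := fun f => multiplication φ ⟨f, memLp_ofReal_mul hφ hc f⟩
      map_add' := fun f g => by rw [← LinearPMap.map_add]; rfl
      map_smul' := fun c f => by rw [RingHom.id_apply, ← LinearPMap.map_smul]; rfl } 1
    fun f => by
      rw [one_mul]
      refine Lp.norm_le_norm_of_ae_le ?_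
      filter_upwards [coeFn_multiplication φ ⟨f, memLp_ofReal_mul hφ hc f⟩] with x hx
      simp only [LinearMap.coe_mk, AddHom.coe_mk, hx, norm_mul, Complex.norm_real]
      exact mul_le_of_le_one_left (norm_nonneg _) (hc x)

theorem coeFn_boundedMul {φ : E → ℝ} (hφ : AEStronglyMeasurable φ volume)
    (hc : ∀ x, |φ x| ≤ 1) (f : L2 n) :
    boundedMul φ hφ hc f =ᵐ[volume] fun x => (φ x : ℂ) * f x :=
  coeFn_multiplication φ ⟨f, memLp_ofReal_mul hφ hc f⟩

theorem continuous_heatSymbol (t : ℝ) :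
    Continuous fun ξ : E => Real.exp (-(t * laplaceSymbol ξ)) :=
  Real.continuous_exp.comp (continuous_laplaceSymbol.const_mul t).neg

theorem abs_heatSymbol_le {t : ℝ} (ht : 0 ≤ t) (ξ : E) :
    |Real.exp (-(t * laplaceSymbol ξ))| ≤ 1 := by
  rw [abs_of_pos (Real.exp_pos _), Real.exp_le_one_iff, neg_nonpos]
  exact mul_nonneg ht (laplaceSymbol_nonneg ξ)

/-- The heat semigroup `exp (t Δ)`. -/
def heat {t : ℝ} (ht : 0 ≤ t) : L2 n →L[ℂ] L2 n :=
  (fourierL2 n).symm.toContinuousLinearEquiv.toContinuousLinearMap ∘L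
    boundedMul _ (continuous_heatSymbol t).aestronglyMeasurable (abs_heatSymbol_le ht) ∘L
    (fourierL2 n).toContinuousLinearEquiv.toContinuousLinearMap

theorem heat_apply {t : ℝ} (ht : 0 ≤ t) (f : L2 n) : heat ht f = (fourierL2 n).symm
    (boundedMul _ (continuous_heatSymbol t).aestronglyMeasurable (abs_heatSymbol_le ht)
      (fourierL2 n f)) :=
  rfl

theorem fourier_heat {t : ℝ} (ht : 0 ≤ t) (f : L2 n) : fourierL2 n (heat ht f) =ᵐ[volume]
    fun ξ => (Real.exp (-(t * laplaceSymbol ξ)) : ℂ) * fourierL2 n f ξ := by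
  rw [heat_apply, LinearIsometryEquiv.apply_symm_apply]
  exact coeFn_boundedMul _ _ _

/-- The semigroup property, for equal times. -/
theorem heat_heat {t : ℝ} (ht : 0 ≤ t) (ht' : 0 ≤ 2 * t) (f : L2 n) :
    heat ht (heat ht f) = heat ht' f := by
  refine (fourierL2 n).injective (Lp.ext ?_)
  filter_upwards [fourier_heat ht (heat ht f), fourier_heat ht f, fourier_heat ht' f]
    with ξ h1 h2 h3
  rw [h1, h2, h3, ← mul_assoc, ← Complex.ofReal_mul, ← Real.exp_add]
  congr 3
  ring

/-- The heat kernel. -/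
def heatKernel (t : ℝ) (z : EuclideanSpace ℝ (Fin n)) : ℝ :=
  (4 * Real.pi * t) ^ (-(n / 2 : ℝ)) * Real.exp (-(‖z‖ ^ 2 / (4 * t)))

theorem heatKernel_nonneg {t : ℝ} (ht : 0 < t) (z : E) : 0 ≤ heatKernel t z := by
  unfold heatKernel; positivity

theorem continuous_heatKernel (t : ℝ) : Continuous (heatKernel (n := n) t) := by
  unfold heatKernel; fun_prop

theorem integral_heatKernel {t : ℝ} (ht : 0 < t) : ∫ z : E, heatKernel t z = 1 := by
  unfold heatKernel
  rw [integral_const_mul]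
  have h := GaussianFourier.integral_rexp_neg_mul_sq_norm (V := E) (b := (4 * t)⁻¹)
    (by positivity)
  have hE : (fun z : E => Real.exp (-(‖z‖ ^ 2 / (4 * t)))) =
      fun z => Real.exp (-(4 * t)⁻¹ * ‖z‖ ^ 2) := by
    ext z; congr 1; ring
  rw [hE, h, finrank_euclideanSpace_fin, div_inv_eq_mul,
    show Real.pi * (4 * t) = 4 * Real.pi * t by ring, ← Real.rpow_add (by positivity)]
  simp

theorem integrable_heatKernel {t : ℝ} (ht : 0 < t) : Integrable (heatKernel (n := n) t) := by
  by_contra h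
  have := integral_heatKernel (n := n) ht
  rw [integral_undef h] at this
  exact zero_ne_one this

/-- On Schwartz functions the heat semigroup is convolution with the heat kernel. -/
theorem heat_toLp_ae_eq {t : ℝ} (ht : 0 < t) (u : 𝓢(EuclideanSpace ℝ (Fin n), ℂ)) :
    heat ht.le (u.toLp 2) =ᵐ[volume] fun x => ∫ y, (heatKernel t (x - y) : ℂ) * u y := by
  obtain ⟨b, hb⟩ : ∃ b : ℝ, b = 4 * Real.pi ^ 2 * t := ⟨_, rfl⟩
  have hbpos : 0 < b := by rw [hb]; positivity
  set G : E → ℂ := fun ξ => (Real.exp (-(t * laplaceSymbol ξ)) : ℂ) * (𝓕 u) ξ with hG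
  have hF : fourierL2 n (u.toLp 2) = (𝓕 u).toLp 2 := SchwartzMap.toLp_fourier_eq u
  have hcoe := (𝓕 u).coeFn_toLp 2 (volume : Measure E)
  have h2 : MemLp G 2 volume := by
    refine (memLp_congr_ae ?_).mp (memLp_ofReal_mul
      (continuous_heatSymbol t).aestronglyMeasurable (abs_heatSymbol_le ht.le)
      ((𝓕 u).toLp 2))
    filter_upwards [hcoe] with x hx
    rw [hx]
  have h1 : Integrable G volume := by
    refine (𝓕 u).integrable.bdd_mul (c := 1)
      (Complex.continuous_ofReal.comp (continuous_heatSymbol t)).aestronglyMeasurable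
      (Filter.Eventually.of_forall fun x => ?_)
    rw [Complex.norm_real]
    exact abs_heatSymbol_le ht.le x
  have heq : heat ht.le (u.toLp 2) = (𝓕⁻ (h2.toLp G) : L2 n) := by
    rw [heat_apply]
    change _ = (fourierL2 n).symm _
    congr 1
    refine Lp.ext ?_
    filter_upwards [coeFn_boundedMul (continuous_heatSymbol t).aestronglyMeasurable
      (abs_heatSymbol_le ht.le) (fourierL2 n (u.toLp 2)), h2.coeFn_toLp, hcoe] with x e1 e2 e3
    rw [e1, e2, hF, e3]
  rw [heq]
  refine (fourierInv_toLp_ae_eq h1 h2).trans (Filter.Eventually.of_forall fun x => ?_)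
  have hJ : Integrable (fun v : E =>
      Complex.exp (-(b : ℂ) * ‖v‖ ^ 2 + 2 * Real.pi * Complex.I * ⟪x, v⟫_ℝ)) volume :=
    GaussianFourier.integrable_cexp_neg_mul_sq_norm_add (by simpa using hbpos) _ _
  have hflip := VectorFourier.integral_fourierIntegral_smul_eq_flip (L := innerₗ E)
    (μ := volume) (ν := volume) Real.continuous_fourierChar continuous_inner hJ u.integrable
  rw [flip_innerₗ] at hflip
  rw [Real.fourierInv_eq']
  calc ∫ v, Complex.exp (((2 * Real.pi * ⟪v, x⟫_ℝ : ℝ) : ℂ) * Complex.I) • G v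
      = ∫ v, Complex.exp (-(b : ℂ) * ‖v‖ ^ 2 + 2 * Real.pi * Complex.I * ⟪x, v⟫_ℝ) •
          (𝓕 u) v := by
        refine integral_congr_ae (Filter.Eventually.of_forall fun v => ?_)
        simp only [hG, smul_eq_mul, ← mul_assoc, laplaceSymbol]
        rw [Complex.ofReal_exp, ← Complex.exp_add]
        congr 2
        rw [hb, real_inner_comm]
        push_cast
        ring
    _ = ∫ y, (𝓕 fun v : E =>
          Complex.exp (-(b : ℂ) * ‖v‖ ^ 2 + 2 * Real.pi * Complex.I * ⟪x, v⟫_ℝ)) y • u y :=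
        hflip.symm
    _ = _ := by
        refine integral_congr_ae (Filter.Eventually.of_forall fun y => ?_)
        simp only [smul_eq_mul]
        rw [fourier_gaussian_innerProductSpace' (by simpa using hbpos)]
        congr 1
        have hbase : Real.pi / b = (4 * Real.pi * t)⁻¹ := by
          rw [hb]
          field_simp
        have hpow : ((Real.pi : ℂ) / (b : ℂ)) ^ ((n : ℂ) / 2) =
            (((4 * Real.pi * t) ^ (-(n / 2 : ℝ)) : ℝ) : ℂ) := by
          rw [Real.rpow_neg (by positivity), ← Real.inv_rpow (by positivity), ← hbase,
            Complex.ofReal_cpow (by positivity)]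
          push_cast
          rfl
        rw [heatKernel, finrank_euclideanSpace_fin, Complex.ofReal_mul, hpow, Complex.ofReal_exp]
        congr 2
        have hπ : (Real.pi : ℂ) ≠ 0 := Complex.ofReal_ne_zero.mpr Real.pi_ne_zero
        have ht0 : (t : ℂ) ≠ 0 := Complex.ofReal_ne_zero.mpr ht.ne'
        rw [hb]
        push_cast
        field_simp

end Heat

open Filter Topology

/-- Jensen's inequality for the power function and a probability density `k`. -/
theorem lintegral_mul_rpow_le {α : Type*} [MeasurableSpace α] {μ : Measure α} {k h : α → ℝ≥0∞}
    (hk : AEMeasurable k μ) (hh : AEMeasurable h μ) (hk1 : ∫⁻ x, k x ∂μ = 1) {r : ℝ}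
    (hr : 1 ≤ r) : (∫⁻ x, k x * h x ∂μ) ^ r ≤ ∫⁻ x, k x * h x ^ r ∂μ := by
  have hr0 : 0 < r := zero_lt_one.trans_le hr
  have h1 : 0 ≤ 1 - r⁻¹ := sub_nonneg.mpr (inv_le_one_of_one_le₀ hr)
  have key := ENNReal.lintegral_mul_norm_pow_le (hk.mul (hh.pow_const r)) hk
    (inv_nonneg.mpr hr0.le) h1 (by ring)
  have hE : ∀ x, (k * fun x => h x ^ r) x ^ r⁻¹ * k x ^ (1 - r⁻¹) = k x * h x := by
    intro x
    rw [Pi.mul_apply, ENNReal.mul_rpow_of_nonneg _ _ (inv_nonneg.mpr hr0.le), ← ENNReal.rpow_mul,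
      mul_inv_cancel₀ hr0.ne', ENNReal.rpow_one, mul_right_comm,
      ← ENNReal.rpow_add_of_nonneg _ _ (inv_nonneg.mpr hr0.le) h1]
    simp
  simp only [hE, hk1, ENNReal.one_rpow, mul_one] at key
  calc (∫⁻ x, k x * h x ∂μ) ^ r
      ≤ ((∫⁻ x, (k * fun x => h x ^ r) x ∂μ) ^ r⁻¹) ^ r := ENNReal.rpow_le_rpow key hr0.le
    _ = _ := by rw [← ENNReal.rpow_mul, inv_mul_cancel₀ hr0.ne', ENNReal.rpow_one]; rfl

/-- A Schur type estimate: if the kernel `k` is a probability density in its second variable and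
`∫ k(x, y) |W x| ^ q dx ≤ A`, then `W` composed with the integral operator of kernel `k` is
bounded in `L²` by `A ^ (1 / q)`. -/
theorem lintegral_weight_mul_kernel_le {α : Type*} [MeasurableSpace α] {μ : Measure α} [SFinite μ]
    {k : α → α → ℝ≥0∞} (hk : Measurable (Function.uncurry k))
    (hk1 : ∀ x, ∫⁻ y, k x y ∂μ = 1) (hk1' : ∀ y, ∫⁻ x, k x y ∂μ = 1)
    {W u : α → ℝ≥0∞} (hW : AEMeasurable W μ) (hu : AEMeasurable u μ) {q : ℝ} (hq : 2 ≤ q)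
    {A : ℝ≥0∞} (hA : ∀ y, ∫⁻ x, k x y * W x ^ q ∂μ ≤ A) :
    ∫⁻ x, W x ^ (2 : ℝ) * (∫⁻ y, k x y * u y ∂μ) ^ (2 : ℝ) ∂μ ≤
      A ^ (2 / q) * ∫⁻ y, u y ^ (2 : ℝ) ∂μ := by
  have hq0 : 0 < q := by linarith
  have hk2 : ∀ x, Measurable (k x) := fun x => hk.comp measurable_prodMk_left
  have hk3 : ∀ y, Measurable fun x => k x y := fun y => hk.comp measurable_prodMk_right
  have hinner : ∀ y, ∫⁻ x, k x y * W x ^ (2 : ℝ) ∂μ ≤ A ^ (2 / q) := by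
    intro y
    have h := lintegral_mul_rpow_le (hk3 y).aemeasurable (hW.pow_const (2 : ℝ)) (hk1' y)
      (r := q / 2) (by linarith)
    simp only [← ENNReal.rpow_mul, mul_div_cancel₀ q (two_ne_zero' ℝ)] at h
    calc ∫⁻ x, k x y * W x ^ (2 : ℝ) ∂μ
        = ((∫⁻ x, k x y * W x ^ (2 : ℝ) ∂μ) ^ (q / 2)) ^ (2 / q) := by
          rw [← ENNReal.rpow_mul, show q / 2 * (2 / q) = 1 by field_simp, ENNReal.rpow_one]
      _ ≤ A ^ (2 / q) := ENNReal.rpow_le_rpow (h.trans (hA y)) (by positivity)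
  calc ∫⁻ x, W x ^ (2 : ℝ) * (∫⁻ y, k x y * u y ∂μ) ^ (2 : ℝ) ∂μ
      ≤ ∫⁻ x, W x ^ (2 : ℝ) * ∫⁻ y, k x y * u y ^ (2 : ℝ) ∂μ ∂μ := by
        gcongr with x
        exact lintegral_mul_rpow_le (hk2 x).aemeasurable hu (hk1 x) one_le_two
    _ = ∫⁻ x, ∫⁻ y, W x ^ (2 : ℝ) * (k x y * u y ^ (2 : ℝ)) ∂μ ∂μ := by
        refine lintegral_congr fun x => ?_
        exact (lintegral_const_mul'' _ ((hk2 x).aemeasurable.mul (hu.pow_const _))).symm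
    _ = ∫⁻ y, ∫⁻ x, W x ^ (2 : ℝ) * (k x y * u y ^ (2 : ℝ)) ∂μ ∂μ :=
        lintegral_lintegral_swap ((hW.pow_const _).comp_fst.mul
          (hk.aemeasurable.mul (hu.pow_const _).comp_snd))
    _ = ∫⁻ y, (∫⁻ x, k x y * W x ^ (2 : ℝ) ∂μ) * u y ^ (2 : ℝ) ∂μ := by
        refine lintegral_congr fun y => ?_
        refine Eq.trans (lintegral_congr fun x => ?_)
          (lintegral_mul_const'' _ ((hk3 y).aemeasurable.mul (hW.pow_const _)))
        ring
    _ ≤ ∫⁻ y, A ^ (2 / q) * u y ^ (2 : ℝ) ∂μ := by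
        gcongr with y
        exact hinner y
    _ = _ := lintegral_const_mul'' _ (hu.pow_const _)

section Estimates

variable {n : ℕ}

local notation "E" => EuclideanSpace ℝ (Fin n)

theorem lintegral_heatKernel {t : ℝ} (ht : 0 < t) (x : E) :
    ∫⁻ y, ENNReal.ofReal (heatKernel t (x - y)) = 1 := by
  rw [lintegral_sub_left_eq_self (fun z : E => ENNReal.ofReal (heatKernel t z)) x,
    ← ofReal_integral_eq_lintegral_ofReal (integrable_heatKernel ht)
      (Eventually.of_forall fun z => heatKernel_nonneg ht z), integral_heatKernel ht,
    ENNReal.ofReal_one]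

theorem heatKernel_sub_comm (t : ℝ) (x y : E) : heatKernel t (x - y) = heatKernel t (y - x) := by
  rw [heatKernel, heatKernel, norm_sub_rev]

variable (n) in
/-- A Gaussian average is controlled by the supremum of the averages over unit balls. -/
theorem exists_lintegral_gaussian_mul_le : ∃ C : ℝ≥0∞, C ≠ ∞ ∧
    ∀ (w : EuclideanSpace ℝ (Fin n) → ℝ≥0∞) (M : ℝ≥0∞), AEMeasurable w volume →
      (∀ x, ∫⁻ y in Metric.ball x 1, w y ≤ M) →
      ∀ y, ∫⁻ x, ENNReal.ofReal (Real.exp (-(‖x - y‖ ^ 2 / 4))) * w x ≤ C * M := by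
  set B : ℝ≥0∞ := volume (Metric.ball (0 : E) 1) with hB
  have hB0 : B ≠ 0 := (Metric.measure_ball_pos volume _ one_pos).ne'
  have hBtop : B ≠ ∞ := measure_ball_lt_top.ne
  set g : E → ℝ≥0∞ := fun z => ENNReal.ofReal (Real.exp (1 / 4 - ‖z‖ ^ 2 / 8)) with hg
  have hgc : Continuous fun z : E => Real.exp (1 / 4 - ‖z‖ ^ 2 / 8) := by fun_prop
  have hgm : Measurable g := hgc.measurable.ennreal_ofReal
  have hgfin : ∫⁻ z, g z ≠ ∞ := by
    have hint : Integrable (fun z : E => Real.exp (1 / 4 - ‖z‖ ^ 2 / 8)) volume := by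
      have := (integrable_heatKernel (n := n) (t := 2) two_pos).const_mul
        (Real.exp (1 / 4) * (4 * Real.pi * 2) ^ (n / 2 : ℝ))
      refine this.congr (Eventually.of_forall fun z => ?_)
      simp only [heatKernel]
      rw [Real.rpow_neg (by positivity), sub_eq_add_neg, Real.exp_add]
      have : ((4 * Real.pi * 2) ^ (n / 2 : ℝ) : ℝ) ≠ 0 := by positivity
      field_simp
      norm_num
    exact hint.lintegral_lt_top.ne
  refine ⟨B⁻¹ * ∫⁻ z, g z, ENNReal.mul_ne_top (ENNReal.inv_ne_top.mpr hB0) hgfin, ?_⟩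
  intro w M hw hM y
  have hgy : Measurable fun z => g (z - y) := hgm.comp (measurable_id.sub_const y)
  have hpt : ∀ x, B * ENNReal.ofReal (Real.exp (-(‖x - y‖ ^ 2 / 4))) ≤
      ∫⁻ z, (Metric.ball x 1).indicator (fun z => g (z - y)) z := by
    intro x
    rw [lintegral_indicator measurableSet_ball, hB, ← Measure.addHaar_ball_center volume x, mul_comm,
      ← setLIntegral_const]
    refine setLIntegral_mono hgy fun z hz => ?_
    refine ENNReal.ofReal_le_ofReal (Real.exp_le_exp.mpr ?_)
    have h1 : ‖z - x‖ < 1 := by simpa [dist_eq_norm] using hz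
    have h2 : ‖z - y‖ ≤ ‖z - x‖ + ‖x - y‖ := norm_sub_le_norm_sub_add_norm_sub z x y
    nlinarith [norm_nonneg (z - x), norm_nonneg (x - y), norm_nonneg (z - y),
      sq_nonneg (‖x - y‖ - 1)]
  have hmeas : AEMeasurable (Function.uncurry fun x z : E =>
      (Metric.ball x 1).indicator (fun z => g (z - y)) z * w x) (volume.prod volume) := by
    refine AEMeasurable.mul (Measurable.aemeasurable ?_) hw.comp_fst
    have hset : MeasurableSet {p : E × E | p.2 ∈ Metric.ball p.1 1} :=
      (isOpen_lt (continuous_snd.dist continuous_fst) continuous_const).measurableSet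
    exact (hgy.comp measurable_snd).indicator hset
  have hmul : B * ∫⁻ x, ENNReal.ofReal (Real.exp (-(‖x - y‖ ^ 2 / 4))) * w x ≤
      (∫⁻ z, g z) * M := by
    calc B * ∫⁻ x, ENNReal.ofReal (Real.exp (-(‖x - y‖ ^ 2 / 4))) * w x
        = ∫⁻ x, B * ENNReal.ofReal (Real.exp (-(‖x - y‖ ^ 2 / 4))) * w x := by
          rw [← lintegral_const_mul' _ _ hBtop]
          simp only [mul_assoc]
      _ ≤ ∫⁻ x, (∫⁻ z, (Metric.ball x 1).indicator (fun z => g (z - y)) z) * w x := by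
          gcongr with x
          exact hpt x
      _ = ∫⁻ x, ∫⁻ z, (Metric.ball x 1).indicator (fun z => g (z - y)) z * w x := by
          refine lintegral_congr fun x => ?_
          rw [lintegral_mul_const _ (hgy.indicator
            measurableSet_ball)]
      _ = ∫⁻ z, ∫⁻ x, (Metric.ball x 1).indicator (fun z => g (z - y)) z * w x :=
          lintegral_lintegral_swap hmeas
      _ = ∫⁻ z, g (z - y) * ∫⁻ x in Metric.ball z 1, w x := by
          refine lintegral_congr fun z => ?_
          rw [← lintegral_indicator measurableSet_ball,
            ← lintegral_const_mul'' _ (hw.indicator measurableSet_ball)]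
          refine lintegral_congr fun x => ?_
          by_cases hx : dist x z < 1
          · rw [Set.indicator_of_mem (Metric.mem_ball'.mpr hx),
              Set.indicator_of_mem (Metric.mem_ball.mpr hx)]
          · rw [Set.indicator_of_notMem (fun h => hx (Metric.mem_ball'.mp h)),
              Set.indicator_of_notMem (fun h => hx (Metric.mem_ball.mp h)), zero_mul, mul_zero]
      _ ≤ ∫⁻ z, g (z - y) * M := by
          gcongr with z
          exact hM z
      _ = (∫⁻ z, g z) * M := by
          rw [lintegral_mul_const _ hgy,
            lintegral_sub_right_eq_self]
  calc ∫⁻ x, ENNReal.ofReal (Real.exp (-(‖x - y‖ ^ 2 / 4))) * w x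
      = B⁻¹ * (B * ∫⁻ x, ENNReal.ofReal (Real.exp (-(‖x - y‖ ^ 2 / 4))) * w x) := by
        rw [← mul_assoc, ENNReal.inv_mul_cancel hB0 hBtop, one_mul]
    _ ≤ B⁻¹ * ((∫⁻ z, g z) * M) := by gcongr
    _ = _ := by rw [mul_assoc]

theorem heatKernel_le {t : ℝ} (ht : 0 < t) (ht1 : t ≤ 1) (z : E) :
    heatKernel t z ≤ t ^ (-(n / 2 : ℝ)) * Real.exp (-(‖z‖ ^ 2 / 4)) := by
  rw [heatKernel, Real.mul_rpow (by positivity) ht.le]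
  have h1 : (4 * Real.pi) ^ (-(n / 2 : ℝ)) ≤ 1 :=
    Real.rpow_le_one_of_one_le_of_nonpos (by linarith [Real.pi_gt_three])
      (neg_nonpos.mpr (by positivity))
  have h2 : Real.exp (-(‖z‖ ^ 2 / (4 * t))) ≤ Real.exp (-(‖z‖ ^ 2 / 4)) := by
    refine Real.exp_le_exp.mpr (neg_le_neg ?_)
    exact div_le_div_of_nonneg_left (by positivity) (by positivity) (by linarith)
  have h3 : (4 * Real.pi) ^ (-(n / 2 : ℝ)) * t ^ (-(n / 2 : ℝ)) ≤ t ^ (-(n / 2 : ℝ)) :=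
    mul_le_of_le_one_left (by positivity) h1
  gcongr

/-- The `L²` norm of a product with a fixed weight is lower semicontinuous in `L²`. -/
theorem eLpNorm_mul_le_of_tendsto {W : E → ℝ} (hW : AEStronglyMeasurable W volume)
    {F : ℕ → L2 n} {f : L2 n} (hF : Tendsto F atTop (𝓝 f)) {c : ℕ → ℝ≥0∞} {c₀ : ℝ≥0∞}
    (hc : Tendsto c atTop (𝓝 c₀))
    (h : ∀ k, eLpNorm (fun x => (W x : ℂ) * F k x) 2 volume ≤ c k) :
    eLpNorm (fun x => (W x : ℂ) * f x) 2 volume ≤ c₀ := by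
  obtain ⟨ns, hns, hae⟩ := (tendstoInMeasure_of_tendsto_Lp hF).exists_seq_tendsto_ae
  have hle := Lp.eLpNorm_lim_le_liminf_eLpNorm (p := 2) (μ := (volume : Measure E))
    (f := fun k x => (W x : ℂ) * F (ns k) x)
    (fun k => (Complex.continuous_ofReal.comp_aestronglyMeasurable hW).mul
      (Lp.aestronglyMeasurable _)) (fun x => (W x : ℂ) * f x) (by
      filter_upwards [hae] with x hx
      exact hx.const_mul _)
  refine hle.trans ?_
  rw [← (hc.comp hns.tendsto_atTop).liminf_eq]
  exact liminf_le_liminf (Eventually.of_forall fun k => h (ns k))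

theorem eLpNorm_two_eq (f : E → ℂ) :
    eLpNorm f 2 volume = (∫⁻ x, ‖f x‖ₑ ^ (2 : ℝ)) ^ (1 / (2 : ℝ)) := by
  rw [eLpNorm_eq_lintegral_rpow_enorm_toReal two_ne_zero ENNReal.ofNat_ne_top]
  simp

theorem eLpNorm_weight_mul_convolution_le {W : E → ℝ} (hW : AEStronglyMeasurable W volume) {q : ℝ}
    (hq : 2 ≤ q) {t : ℝ} (ht : 0 < t) {A : ℝ≥0∞}
    (hA : ∀ y, ∫⁻ x, ENNReal.ofReal (heatKernel t (x - y)) * ‖W x‖ₑ ^ q ≤ A)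
    {u v : E → ℂ} (hu : AEStronglyMeasurable u volume)
    (hv : v =ᵐ[volume] fun x => ∫ y, (heatKernel t (x - y) : ℂ) * u y) :
    eLpNorm (fun x => (W x : ℂ) * v x) 2 volume ≤ A ^ (1 / q) * eLpNorm u 2 volume := by
  have hq0 : 0 < q := by linarith
  have hk : Measurable (Function.uncurry fun x y : E => ENNReal.ofReal (heatKernel t (x - y))) :=
    ((continuous_heatKernel t).comp
      (continuous_fst.sub continuous_snd)).measurable.ennreal_ofReal
  have hmain := lintegral_weight_mul_kernel_le (μ := (volume : Measure E)) hk
    (lintegral_heatKernel ht) (fun y => by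
      simp only [heatKernel_sub_comm t _ y]; exact lintegral_heatKernel ht y)
    hW.enorm hu.enorm hq hA
  have hle : ∫⁻ x, ‖(W x : ℂ) * v x‖ₑ ^ (2 : ℝ) ≤ ∫⁻ x, ‖W x‖ₑ ^ (2 : ℝ) *
      (∫⁻ y, ENNReal.ofReal (heatKernel t (x - y)) * ‖u y‖ₑ) ^ (2 : ℝ) := by
    refine lintegral_mono_ae ?_
    filter_upwards [hv] with x hx
    have hWx : ‖(W x : ℂ)‖ₑ = ‖W x‖ₑ := by
      rw [← ofReal_norm, ← ofReal_norm, Complex.norm_real]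
    rw [hx, enorm_mul, ENNReal.mul_rpow_of_nonneg _ _ zero_le_two, hWx]
    gcongr
    refine (enorm_integral_le_lintegral_enorm _).trans_eq (lintegral_congr fun y => ?_)
    rw [enorm_mul, ← ofReal_norm (heatKernel t (x - y) : ℂ), Complex.norm_real,
      Real.norm_of_nonneg (heatKernel_nonneg ht _)]
  rw [eLpNorm_two_eq, eLpNorm_two_eq]
  refine (ENNReal.rpow_le_rpow (hle.trans hmain) (by positivity)).trans_eq ?_
  rw [ENNReal.mul_rpow_of_nonneg _ _ (by positivity), ← ENNReal.rpow_mul]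
  congr 2
  field_simp

theorem eLpNorm_weight_mul_heat_le {W : E → ℝ} (hW : AEStronglyMeasurable W volume) {q : ℝ}
    (hq : 2 ≤ q) {t : ℝ} (ht : 0 < t) {A : ℝ≥0∞} (hAtop : A ≠ ∞)
    (hA : ∀ y, ∫⁻ x, ENNReal.ofReal (heatKernel t (x - y)) * ‖W x‖ₑ ^ q ≤ A) (f : L2 n) :
    eLpNorm (fun x => (W x : ℂ) * heat ht.le f x) 2 volume ≤ A ^ (1 / q) * ‖f‖ₑ := by
  have hq0 : 0 < q := by linarith
  have hschwartz : ∀ u : 𝓢(EuclideanSpace ℝ (Fin n), ℂ),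
      eLpNorm (fun x => (W x : ℂ) * heat ht.le (u.toLp 2) x) 2 volume ≤
        A ^ (1 / q) * ‖u.toLp 2 (volume : Measure E)‖ₑ := by
    intro u
    have hnorm : ‖u.toLp 2 (volume : Measure E)‖ₑ = eLpNorm u 2 volume :=
      (Lp.enorm_def _).trans (eLpNorm_congr_ae (u.coeFn_toLp 2 volume))
    rw [hnorm]
    exact eLpNorm_weight_mul_convolution_le hW hq ht hA u.continuous.aestronglyMeasurable
      (heat_toLp_ae_eq ht u)
  obtain ⟨F, hF, hlim⟩ := mem_closure_iff_seq_limit.mp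
    (SchwartzMap.denseRange_toLpCLM (p := 2) (μ := volume)
      ENNReal.ofNat_ne_top f)
  refine eLpNorm_mul_le_of_tendsto hW (((heat ht.le).continuous.tendsto f).comp hlim)
    (ENNReal.Tendsto.const_mul hlim.enorm
      (Or.inr (ENNReal.rpow_ne_top_of_nonneg (by positivity) hAtop))) fun k => ?_
  obtain ⟨u, hu⟩ := hF k
  rw [Function.comp_apply, ← hu]
  exact hschwartz u

/-- Local smoothing of the heat semigroup: for `W` uniformly locally in `L ^ q`, the norm of
`W exp (t Δ)` is `O (t ^ (-n / (2 q)))` as `t` tends to `0`. -/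
theorem exists_eLpNorm_weight_mul_heat_le {W : E → ℝ} (hW : AEStronglyMeasurable W volume) {q : ℝ}
    (hq : 2 ≤ q) {M : ℝ≥0∞} (hM : M ≠ ∞) (hWM : ∀ x, ∫⁻ y in Metric.ball x 1, ‖W y‖ₑ ^ q ≤ M) :
    ∃ K : ℝ, 0 ≤ K ∧ ∀ (t : ℝ) (ht : 0 < t), t ≤ 1 → ∀ f : L2 n,
      eLpNorm (fun x => (W x : ℂ) * heat ht.le f x) 2 volume ≤
        ENNReal.ofReal (K * t ^ (-(n / (2 * q))) * ‖f‖) := by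
  have hq0 : 0 < q := by linarith
  obtain ⟨C, hC, hgauss⟩ := exists_lintegral_gaussian_mul_le n
  have hCM : C * M ≠ ∞ := ENNReal.mul_ne_top hC hM
  refine ⟨((C * M) ^ (1 / q)).toReal, ENNReal.toReal_nonneg, fun t ht ht1 f => ?_⟩
  have hbound : ∀ y, ∫⁻ x, ENNReal.ofReal (heatKernel t (x - y)) * ‖W x‖ₑ ^ q ≤
      ENNReal.ofReal (t ^ (-(n / 2 : ℝ))) * (C * M) := by
    intro y
    calc ∫⁻ x, ENNReal.ofReal (heatKernel t (x - y)) * ‖W x‖ₑ ^ q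
        ≤ ∫⁻ x, ENNReal.ofReal (t ^ (-(n / 2 : ℝ))) *
            (ENNReal.ofReal (Real.exp (-(‖x - y‖ ^ 2 / 4))) * ‖W x‖ₑ ^ q) := by
          refine lintegral_mono fun x => ?_
          rw [← mul_assoc, ← ENNReal.ofReal_mul (by positivity)]
          gcongr
          exact heatKernel_le ht ht1 _
      _ = ENNReal.ofReal (t ^ (-(n / 2 : ℝ))) *
            ∫⁻ x, ENNReal.ofReal (Real.exp (-(‖x - y‖ ^ 2 / 4))) * ‖W x‖ₑ ^ q :=
          lintegral_const_mul' _ _ ENNReal.ofReal_ne_top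
      _ ≤ _ := by
          gcongr
          exact hgauss _ M (hW.enorm.pow_const q) hWM y
  refine (eLpNorm_weight_mul_heat_le hW hq ht
    (ENNReal.mul_ne_top ENNReal.ofReal_ne_top hCM) hbound f).trans_eq ?_
  have hK : (C * M) ^ (1 / q) ≠ ∞ := ENNReal.rpow_ne_top_of_nonneg (by positivity) hCM
  rw [ENNReal.ofReal_mul (by positivity), ofReal_norm, ENNReal.ofReal_mul ENNReal.toReal_nonneg,
    ENNReal.ofReal_toReal hK, ENNReal.mul_rpow_of_nonneg _ _ (by positivity),
    ENNReal.ofReal_rpow_of_nonneg (by positivity) (by positivity), ← Real.rpow_mul ht.le,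
    mul_comm (ENNReal.ofReal _)]
  congr 4
  field_simp

end Estimates

section RelativeBound

variable {n : ℕ}

local notation "E" => EuclideanSpace ℝ (Fin n)

/-- The power `(-Δ) ^ s`. -/
def laplacePower (n : ℕ) (s : ℝ) : L2 n →ₗ.[ℂ] L2 n :=
  unitaryConj (fourierL2 n) (multiplication fun ξ => laplaceSymbol ξ ^ s)

theorem aestronglyMeasurable_laplaceSymbol_rpow (s : ℝ) :
    AEStronglyMeasurable (fun ξ : E => laplaceSymbol ξ ^ s) volume :=
  (continuous_laplaceSymbol.measurable.pow_const s).aestronglyMeasurable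

theorem isSelfAdjoint_laplacePower (s : ℝ) : IsSelfAdjoint (laplacePower n s) :=
  isSelfAdjoint_unitaryConj _
    (isSelfAdjoint_multiplication (aestronglyMeasurable_laplaceSymbol_rpow s))

theorem laplacePower_one : laplacePower n 1 = freeHamiltonian n := by
  rw [freeHamiltonian_eq, laplacePower]
  simp only [Real.rpow_one]

theorem isSqrtAbs_laplacePower : IsSqrtAbs (laplacePower n (1 / 2)) (freeHamiltonian n) := by
  refine ⟨freeHamiltonian n, isAbs_self ?_ ?_, ?_⟩
  · rw [← laplacePower_one]
    exact isSelfAdjoint_laplacePower 1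
  · rw [freeHamiltonian_eq]
    exact isNonneg_unitaryConj _ (isNonneg_multiplication laplaceSymbol_nonneg)
  · rw [freeHamiltonian_eq]
    refine (isSqrt_multiplication (aestronglyMeasurable_laplaceSymbol_rpow _)
      (fun ξ => Real.rpow_nonneg (laplaceSymbol_nonneg ξ) _) fun ξ => ?_).unitaryConj _
    rw [← Real.sqrt_eq_rpow, Real.mul_self_sqrt (laplaceSymbol_nonneg ξ)]

theorem one_sub_exp_neg_le_rpow {x s : ℝ} (hx : 0 ≤ x) (hs : 0 < s) (hs1 : s ≤ 1) :
    1 - Real.exp (-x) ≤ x ^ s := by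
  rcases le_total x 1 with h | h
  · calc 1 - Real.exp (-x) ≤ x := by linarith [Real.add_one_le_exp (-x)]
      _ = x ^ (1 : ℝ) := (Real.rpow_one x).symm
      _ ≤ x ^ s := Real.rpow_le_rpow_of_exponent_ge' hx h hs.le hs1
  · linarith [Real.exp_pos (-x), Real.one_le_rpow h hs.le]

theorem norm_sub_heat_le {s : ℝ} (hs : 0 < s) (hs1 : s ≤ 1) {t : ℝ} (ht : 0 ≤ t)
    (f : (laplacePower n s).domain) :
    ‖(f : L2 n) - heat ht (f : L2 n)‖ ≤ t ^ s * ‖laplacePower n s f‖ := by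
  have hA : laplacePower n s f = (fourierL2 n).symm
      (multiplication (fun ξ => laplaceSymbol ξ ^ s) ⟨fourierL2 n (f : L2 n), f.2⟩) := rfl
  rw [hA, LinearIsometryEquiv.norm_map, ← (fourierL2 n).norm_map, map_sub]
  refine Lp.norm_le_mul_norm_of_ae_le_mul ?_
  filter_upwards [Lp.coeFn_sub (fourierL2 n (f : L2 n)) (fourierL2 n (heat ht (f : L2 n))),
    fourier_heat ht (f : L2 n), coeFn_multiplication (fun ξ => laplaceSymbol ξ ^ s)
      ⟨fourierL2 n (f : L2 n), f.2⟩] with ξ h1 h2 h3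
  have h0 := laplaceSymbol_nonneg ξ
  rw [h1, Pi.sub_apply, h2, h3, ← one_sub_mul, norm_mul, norm_mul, ← mul_assoc,
    ← Complex.ofReal_one, ← Complex.ofReal_sub, Complex.norm_real, Complex.norm_real,
    Real.norm_of_nonneg (Real.rpow_nonneg h0 _), ← Real.mul_rpow ht h0, Real.norm_of_nonneg
      (sub_nonneg.mpr ((le_abs_self _).trans (abs_heatSymbol_le ht ξ)))]
  exact mul_le_mul_of_nonneg_right (one_sub_exp_neg_le_rpow (mul_nonneg ht h0) hs hs1)
    (norm_nonneg _)

theorem eLpNorm_weight_mul_add_le {W : E → ℝ} (hW : AEStronglyMeasurable W volume) (f g : L2 n) :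
    eLpNorm (fun x => (W x : ℂ) * (f + g : L2 n) x) 2 volume ≤
      eLpNorm (fun x => (W x : ℂ) * f x) 2 volume +
        eLpNorm (fun x => (W x : ℂ) * g x) 2 volume := by
  have hm : ∀ h : L2 n, AEStronglyMeasurable (fun x => (W x : ℂ) * h x) volume := fun h =>
    (Complex.continuous_ofReal.comp_aestronglyMeasurable hW).mul (Lp.aestronglyMeasurable _)
  rw [eLpNorm_congr_ae (mul_add_ae W f g)]
  exact eLpNorm_add_le (hm f) (hm g) one_le_two

/-- Dyadic summation of the smoothing estimate: if `‖W exp (t Δ)‖ ≤ K t ^ (-θ)` for small `t`, then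
`W` is bounded by `(-Δ) ^ s` for `s > θ`, with constants that depend on the scale `T`. -/
theorem eLpNorm_weight_mul_le {W : E → ℝ} (hW : AEStronglyMeasurable W volume) {K θ s : ℝ}
    (hK : 0 ≤ K) (hs : 0 < s) (hs1 : s ≤ 1) (hθ : θ < s)
    (hheat : ∀ (t : ℝ) (ht : 0 < t), t ≤ 1 → ∀ f : L2 n,
      eLpNorm (fun x => (W x : ℂ) * heat ht.le f x) 2 volume ≤ ENNReal.ofReal (K * t ^ (-θ) * ‖f‖))
    {T : ℝ} (hT : 0 < T) (hT1 : T ≤ 1) (f : (laplacePower n s).domain) :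
    eLpNorm (fun x => (W x : ℂ) * (f : L2 n) x) 2 volume ≤ ENNReal.ofReal
      (K * T ^ (-θ) * ‖(f : L2 n)‖ +
        K * (2 ^ (s - θ) - 1)⁻¹ * T ^ (s - θ) * ‖laplacePower n s f‖) := by
  set R := ‖laplacePower n s f‖
  have hγ : 0 < s - θ := sub_pos.mpr hθ
  have h2γ : 0 < (2 : ℝ) ^ (s - θ) - 1 := sub_pos.mpr (Real.one_lt_rpow one_lt_two hγ)
  have hpos : ∀ k : ℕ, 0 < T / 2 ^ k := fun k => by positivity
  have hle1 : ∀ k : ℕ, T / 2 ^ k ≤ 1 := fun k =>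
    (div_le_self hT.le (one_le_pow₀ one_le_two)).trans hT1
  have hstep : ∀ k : ℕ, eLpNorm (fun x => (W x : ℂ) * heat (hpos k).le (f : L2 n) x) 2 volume ≤
      ENNReal.ofReal (K * T ^ (-θ) * ‖(f : L2 n)‖ +
        K * (2 ^ (s - θ) - 1)⁻¹ * (T ^ (s - θ) - (T / 2 ^ k) ^ (s - θ)) * R) := by
    intro k
    induction k with
    | zero =>
      refine (hheat _ (hpos 0) (hle1 0) f).trans (ENNReal.ofReal_le_ofReal ?_)
      simp
    | succ k ih =>
      set τ := T / 2 ^ (k + 1) with hτ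
      have hτk : T / 2 ^ k = 2 * τ := by rw [hτ, pow_succ]; field_simp
      have hsplit : heat (hpos (k + 1)).le (f : L2 n) = heat (hpos k).le (f : L2 n) +
          heat (hpos (k + 1)).le ((f : L2 n) - heat (hpos (k + 1)).le (f : L2 n)) := by
        have hh : heat (hpos k).le (f : L2 n) =
            heat (hpos (k + 1)).le (heat (hpos (k + 1)).le (f : L2 n)) := by
          have h2τ : 0 ≤ 2 * τ := hτk ▸ (hpos k).le
          rw [heat_heat _ h2τ]
          congr! 2
        rw [map_sub, hh]
        abel
      rw [hsplit]
      refine (eLpNorm_weight_mul_add_le hW _ _).trans ((add_le_add ih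
        (hheat _ (hpos (k + 1)) (hle1 (k + 1)) _)).trans ?_)
      have hτ0 : 0 < τ := hpos (k + 1)
      have hdiff : K * τ ^ (-θ) * ‖(f : L2 n) - heat (hpos (k + 1)).le (f : L2 n)‖ ≤
          K * τ ^ (s - θ) * R := by
        calc _ ≤ K * τ ^ (-θ) * (τ ^ s * R) := by
              gcongr
              exact norm_sub_heat_le hs hs1 (hpos (k + 1)).le f
          _ = _ := by
              rw [sub_eq_neg_add, Real.rpow_add hτ0]
              ring
      have hmono : (T / 2 ^ k) ^ (s - θ) ≤ T ^ (s - θ) :=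
        Real.rpow_le_rpow (hpos k).le (div_le_self hT.le (one_le_pow₀ one_le_two)) hγ.le
      rw [← ENNReal.ofReal_add (add_nonneg (by positivity) (mul_nonneg (mul_nonneg
        (mul_nonneg hK (inv_nonneg.mpr h2γ.le)) (sub_nonneg.mpr hmono)) (norm_nonneg _)))
        (by positivity)]
      refine ENNReal.ofReal_le_ofReal ((add_le_add_right hdiff _).trans_eq ?_)
      rw [hτk, Real.mul_rpow zero_le_two hτ0.le]
      field_simp
      ring
  have htend : Tendsto (fun k : ℕ => heat (hpos k).le (f : L2 n)) atTop (𝓝 (f : L2 n)) := by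
    rw [tendsto_iff_norm_sub_tendsto_zero]
    have hlim : Tendsto (fun k : ℕ => (T / 2 ^ k) ^ s * R) atTop (𝓝 0) := by
      have h1 : Tendsto (fun k : ℕ => T / 2 ^ k) atTop (𝓝 0) := by
        have := (tendsto_pow_atTop_nhds_zero_of_lt_one (r := (1 / 2 : ℝ)) (by norm_num)
          (by norm_num)).const_mul T
        simpa [div_eq_mul_inv] using this
      have h2 := (h1.rpow_const (p := s) (Or.inr hs.le)).mul_const R
      rwa [Real.zero_rpow hs.ne', zero_mul] at h2
    refine squeeze_zero (fun k => norm_nonneg _) (fun k => ?_) hlim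
    rw [norm_sub_rev]
    exact norm_sub_heat_le hs hs1 (hpos k).le f
  refine eLpNorm_mul_le_of_tendsto hW htend tendsto_const_nhds fun k => (hstep k).trans ?_
  refine ENNReal.ofReal_le_ofReal ?_
  have : 0 ≤ (T / 2 ^ k) ^ (s - θ) := Real.rpow_nonneg (hpos k).le _
  gcongr
  linarith

/-- A weight uniformly locally in `L ^ q`, `q ≥ 2`, is infinitesimally bounded with respect to
`(-Δ) ^ s` when `n < 2 q s`. -/
theorem infinitesimallyBounded_laplacePower {W : E → ℝ} (hW : AEStronglyMeasurable W volume)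
    {q s : ℝ} (hq : 2 ≤ q) (hs : 0 < s) (hs1 : s ≤ 1) (hqs : n / (2 * q) < s) {M : ℝ≥0∞}
    (hM : M ≠ ∞) (hWM : ∀ x, ∫⁻ y in Metric.ball x 1, ‖W y‖ₑ ^ q ≤ M) :
    InfinitesimallyBounded (laplacePower n s) (multiplication W) := by
  obtain ⟨K, hK, hheat⟩ := exists_eLpNorm_weight_mul_heat_le hW hq hM hWM
  have hbound := fun {T : ℝ} (hT : 0 < T) (hT1 : T ≤ 1) (f : (laplacePower n s).domain) =>
    eLpNorm_weight_mul_le hW hK hs hs1 hqs hheat hT hT1 f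
  have hmeas : ∀ f : L2 n, AEStronglyMeasurable (fun x => (W x : ℂ) * f x) volume := fun f =>
    (Complex.continuous_ofReal.comp_aestronglyMeasurable hW).mul (Lp.aestronglyMeasurable _)
  have hdom : (laplacePower n s).domain ≤ (multiplication W).domain := fun f hf =>
    ⟨hmeas f, (hbound one_pos le_rfl ⟨f, hf⟩).trans_lt ENNReal.ofReal_lt_top⟩
  refine ⟨(isSelfAdjoint_laplacePower s).isClosed,
    (isSelfAdjoint_multiplication hW).isClosed.isClosable, hdom, fun a ha => ?_⟩
  set L := K * (2 ^ (s - n / (2 * q)) - 1)⁻¹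
  have hγ : 0 < s - n / (2 * q) := sub_pos.mpr hqs
  obtain ⟨T, hT, hT1, hTa⟩ : ∃ T : ℝ, 0 < T ∧ T ≤ 1 ∧ L * T ^ (s - n / (2 * q)) ≤ a := by
    have hlim : Tendsto (fun T : ℝ => L * T ^ (s - n / (2 * q))) (𝓝[>] 0) (𝓝 0) := by
      have h := ((tendsto_id (x := 𝓝 (0 : ℝ))).rpow_const
        (p := s - n / (2 * q)) (Or.inr hγ.le)).const_mul L
      simp only [id, Real.zero_rpow hγ.ne', mul_zero] at h
      exact h.mono_left nhdsWithin_le_nhds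
    obtain ⟨T, h1, h2⟩ := ((hlim.eventually_le_const ha).and
      (Ioc_mem_nhdsGT (zero_lt_one' ℝ))).exists
    exact ⟨T, h2.1, h2.2, h1⟩
  refine ⟨K * T ^ (-(n / (2 * q))), by positivity, fun f => ?_⟩
  have hb := hbound hT hT1 f
  have hnorm : ‖multiplication W (Submodule.inclusion hdom f)‖ =
      (eLpNorm (fun x => (W x : ℂ) * (f : L2 n) x) 2 volume).toReal := by
    rw [Lp.norm_def, eLpNorm_congr_ae (coeFn_multiplication W (Submodule.inclusion hdom f))]
    rfl
  rw [hnorm]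
  refine (ENNReal.toReal_mono ENNReal.ofReal_ne_top hb).trans ?_
  have hnn : 0 ≤ L := mul_nonneg hK (inv_nonneg.mpr (sub_nonneg.mpr
    (Real.one_lt_rpow one_lt_two hγ).le))
  rw [ENNReal.toReal_ofReal (by positivity), add_comm]
  gcongr

theorem MemLpLocUnif.aestronglyMeasurable {V : E → ℝ} {p : ℝ≥0∞} (hV : MemLpLocUnif V p) :
    AEStronglyMeasurable V volume := by
  have h : ∀ k : ℕ, AEStronglyMeasurable V (volume.restrict (Metric.closedBall (0 : E) k)) :=
    fun k => (hV.1 _ (isCompact_closedBall 0 k)).1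
  have := aestronglyMeasurable_iUnion_iff.mpr h
  rwa [Metric.iUnion_closedBall_nat, Measure.restrict_univ] at this

theorem MemLpLocUnif.exists_lintegral_ball_le {V : E → ℝ} {p : ℝ} (hp : 0 < p)
    (hV : MemLpLocUnif V (ENNReal.ofReal p)) :
    ∃ M : ℝ≥0∞, M ≠ ∞ ∧ ∀ x, ∫⁻ y in Metric.ball x 1, ‖V y‖ₑ ^ p ≤ M := by
  refine ⟨_, ENNReal.rpow_ne_top_of_nonneg hp.le hV.2.ne, fun x => ?_⟩
  have h := le_iSup (fun x : E => eLpNorm ((Metric.ball x 1).indicator V) (ENNReal.ofReal p) volume)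
    x
  refine le_trans (le_of_eq ?_) (ENNReal.rpow_le_rpow h hp.le)
  rw [eLpNorm_indicator_eq_eLpNorm_restrict measurableSet_ball,
    eLpNorm_eq_lintegral_rpow_enorm_toReal (by simpa using hp) ENNReal.ofReal_ne_top,
    ENNReal.toReal_ofReal hp.le, ← ENNReal.rpow_mul, one_div_mul_cancel hp.ne', ENNReal.rpow_one]

theorem enorm_sqrt_abs_rpow (v p : ℝ) : ‖√|v|‖ₑ ^ (2 * p) = ‖v‖ₑ ^ p := by
  rw [ENNReal.rpow_mul]
  congr 1
  rw [ENNReal.rpow_two, ← enorm_pow, Real.sq_sqrt (abs_nonneg v), Real.enorm_abs]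

end RelativeBound

end RelativeBounds

end

theorem corollaryc3p5 (n : ℕ) (hn : 1 ≤ n) (p : ℝ)
    (hp_low : n ≤ 3 → p = 2) (hp_high : 4 ≤ n → (n : ℝ) / 2 < p)
    (V : EuclideanSpace ℝ (Fin n) → ℝ)
    (hV : RelativeBounds.MemLpLocUnif V (ENNReal.ofReal p)) :
    RelativeBounds.InfinitesimallyBounded
        (RelativeBounds.freeHamiltonian n) (RelativeBounds.multiplication V) ∧
      RelativeBounds.InfinitesimallyFormBounded
        (RelativeBounds.freeHamiltonian n) (RelativeBounds.multiplication V) := by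
  have hp : 2 ≤ p ∧ (n : ℝ) < 2 * p := by
    rcases le_or_gt n 3 with h | h
    · have : (n : ℝ) ≤ 3 := by exact_mod_cast h
      rw [hp_low h]
      exact ⟨le_rfl, by linarith⟩
    · have h4 : (4 : ℝ) ≤ n := by exact_mod_cast h
      have := hp_high h
      exact ⟨by linarith, by linarith⟩
  have hVm := hV.aestronglyMeasurable
  have hp0 : 0 < p := by linarith [hp.1]
  obtain ⟨M, hM, hVM⟩ := hV.exists_lintegral_ball_le hp0
  have hself : IsSelfAdjoint (RelativeBounds.multiplication V) :=
    RelativeBounds.isSelfAdjoint_multiplication hVm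
  refine ⟨?_, ?_, ?_, hself.dense_domain, hself.isClosed,
    RelativeBounds.laplacePower n (1 / 2), RelativeBounds.multiplication fun x => √|V x|,
    RelativeBounds.isSqrtAbs_laplacePower, RelativeBounds.isSqrtAbs_multiplication hVm, ?_⟩
  · rw [← RelativeBounds.laplacePower_one]
    refine RelativeBounds.infinitesimallyBounded_laplacePower hVm hp.1 one_pos le_rfl ?_ hM hVM
    rw [div_lt_one (by positivity)]
    exact hp.2
  · rw [← RelativeBounds.laplacePower_one]
    exact RelativeBounds.isSelfAdjoint_laplacePower 1
  · refine ⟨0, fun f => ?_⟩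
    rw [zero_mul]
    revert f
    rw [RelativeBounds.freeHamiltonian_eq]
    exact RelativeBounds.isNonneg_unitaryConj _
      (RelativeBounds.isNonneg_multiplication RelativeBounds.laplaceSymbol_nonneg)
  · refine RelativeBounds.infinitesimallyBounded_laplacePower (W := fun x => √|V x|)
      (Real.continuous_sqrt.comp_aestronglyMeasurable hVm.norm) (q := 2 * p) (by linarith [hp.1])
      one_half_pos one_half_lt_one.le ?_ hM
      (by simpa only [RelativeBounds.enorm_sqrt_abs_rpow] using hVM)
    rw [div_lt_div_iff₀ (by positivity) two_pos]
    linarith [hp.2]
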